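/- Let $\Bbbk$ be a field. Let $\mathcal{TL}_0(\Bbbk)$ be the strict $\Bbbk$-linear monoidal category with objects $[0],[1],[2],\dots$, tensor product $[m]\otimes[n]=[m+n]$ and unit $[0]$, whose morphisms are generated by $\mathrm{cup}:[0]\to[2]$ and $\mathrm{cap}:[2]\to[0]$ subject to the relations $$(\mathrm{cap}\otimes \mathrm{id}_{[1]})\circ(\mathrm{id}_{[1]}\otimes\mathrm{cup})=0=(\mathrm{id}_{[1]}\otimes\mathrm{cap})\circ(\mathrm{cup}\otimes\mathrm{id}_{[1]}),\qquad \mathrm{cap}\circ\mathrm{cup}=\mathrm{id}_{[0]}.$$ Let $\mathbf{CrysTL}$ be its Cauchy completion, that is, the Karoubi (idempotent-splitting) envelope of the additive envelope of $\mathcal{TL}_0(\Bbbk)$. Then $\mathbf{CrysTL}$ is semisimple: it is additive, and every object is a direct sum of finitely many simple objects, where an object is called simple if it is nonzero and each of its nonzero endomorphisms is an isomorphism. Moreover, for every object $X$ of $\mathbf{CrysTL}$ the endomorphism algebra $\mathrm{End}(X)$ is a semisimple ring. -/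

import Mathlib

open CategoryTheory CategoryTheory.Limits

universe u

/-- Formal expressions for the morphisms `m ⟶ n` of the `k`-linear strict monoidal category with
object monoid `(ℕ, +, 0)` generated by `cup : 0 ⟶ 2` and `cap : 2 ⟶ 0`.
Composition is written in diagrammatic order: `comp f g` is "first `f`, then `g`". -/
inductive TLTerm (k : Type u) : ℕ → ℕ → Type u
  | cup : TLTerm k 0 2
  | cap : TLTerm k 2 0
  | id (n : ℕ) : TLTerm k n n
  | comp {m n p : ℕ} (f : TLTerm k m n) (g : TLTerm k n p) : TLTerm k m p
  | tensor {m n m' n' : ℕ} (f : TLTerm k m n) (g : TLTerm k m' n') : TLTerm k (m + m') (n + n')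
  | zero (m n : ℕ) : TLTerm k m n
  | add {m n : ℕ} (f g : TLTerm k m n) : TLTerm k m n
  | smul {m n : ℕ} (c : k) (f : TLTerm k m n) : TLTerm k m n

namespace TLTerm

/-- Transport of an expression along equalities of its source and target. -/
def cast {k : Type u} {m n m' n' : ℕ} (hm : m = m') (hn : n = n') (f : TLTerm k m n) :
    TLTerm k m' n' :=
  hm ▸ hn ▸ f

/-- The relation generated by the axioms of a `k`-linear strict monoidal category and by the
defining relations of the renormalized Temperley--Lieb category at the parameter `a`:
both zig-zags are equal to `a • id₁` and the circle is equal to `(a ^ 2 + 1) • id₀`. -/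
inductive Rel {k : Type u} [Field k] (a : k) :
    {m n : ℕ} → TLTerm k m n → TLTerm k m n → Prop
  -- equivalence relation
  | refl {m n : ℕ} (f : TLTerm k m n) : Rel a f f
  | symm {m n : ℕ} {f g : TLTerm k m n} : Rel a f g → Rel a g f
  | trans {m n : ℕ} {f g h : TLTerm k m n} : Rel a f g → Rel a g h → Rel a f h
  -- compatibility with all the operations
  | comp_congr {m n p : ℕ} {f f' : TLTerm k m n} {g g' : TLTerm k n p} :
      Rel a f f' → Rel a g g' → Rel a (f.comp g) (f'.comp g')
  | tensor_congr {m n m' n' : ℕ} {f f' : TLTerm k m n} {g g' : TLTerm k m' n'} :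
      Rel a f f' → Rel a g g' → Rel a (f.tensor g) (f'.tensor g')
  | add_congr {m n : ℕ} {f f' g g' : TLTerm k m n} :
      Rel a f f' → Rel a g g' → Rel a (f.add g) (f'.add g')
  | smul_congr {m n : ℕ} (c : k) {f f' : TLTerm k m n} :
      Rel a f f' → Rel a (smul c f) (smul c f')
  -- each morphism space is a `k`-module
  | add_assoc {m n : ℕ} (f g h : TLTerm k m n) : Rel a ((f.add g).add h) (f.add (g.add h))
  | add_comm {m n : ℕ} (f g : TLTerm k m n) : Rel a (f.add g) (g.add f)
  | zero_add {m n : ℕ} (f : TLTerm k m n) : Rel a ((zero m n).add f) f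
  | one_smul {m n : ℕ} (f : TLTerm k m n) : Rel a (smul 1 f) f
  | zero_smul {m n : ℕ} (f : TLTerm k m n) : Rel a (smul 0 f) (zero m n)
  | mul_smul {m n : ℕ} (c d : k) (f : TLTerm k m n) :
      Rel a (smul (c * d) f) (smul c (smul d f))
  | add_smul {m n : ℕ} (c d : k) (f : TLTerm k m n) :
      Rel a (smul (c + d) f) ((smul c f).add (smul d f))
  | smul_add {m n : ℕ} (c : k) (f g : TLTerm k m n) :
      Rel a (smul c (f.add g)) ((smul c f).add (smul c g))
  -- category axioms
  | id_comp {m n : ℕ} (f : TLTerm k m n) : Rel a ((id m).comp f) f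
  | comp_id {m n : ℕ} (f : TLTerm k m n) : Rel a (f.comp (id n)) f
  | comp_assoc {m n p q : ℕ} (f : TLTerm k m n) (g : TLTerm k n p) (h : TLTerm k p q) :
      Rel a ((f.comp g).comp h) (f.comp (g.comp h))
  -- composition is bilinear
  | add_comp {m n p : ℕ} (f f' : TLTerm k m n) (g : TLTerm k n p) :
      Rel a ((f.add f').comp g) ((f.comp g).add (f'.comp g))
  | comp_add {m n p : ℕ} (f : TLTerm k m n) (g g' : TLTerm k n p) :
      Rel a (f.comp (g.add g')) ((f.comp g).add (f.comp g'))
  | smul_comp {m n p : ℕ} (c : k) (f : TLTerm k m n) (g : TLTerm k n p) :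
      Rel a ((smul c f).comp g) (smul c (f.comp g))
  | comp_smul {m n p : ℕ} (c : k) (f : TLTerm k m n) (g : TLTerm k n p) :
      Rel a (f.comp (smul c g)) (smul c (f.comp g))
  -- the tensor product is a bifunctor
  | tensor_id (m n : ℕ) : Rel a ((id m).tensor (id n)) (id (m + n))
  | interchange {m n p m' n' p' : ℕ} (f : TLTerm k m n) (g : TLTerm k n p)
      (f' : TLTerm k m' n') (g' : TLTerm k n' p') :
      Rel a ((f.comp g).tensor (f'.comp g')) ((f.tensor f').comp (g.tensor g'))
  -- the tensor product is bilinear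
  | add_tensor {m n m' n' : ℕ} (f f' : TLTerm k m n) (g : TLTerm k m' n') :
      Rel a ((f.add f').tensor g) ((f.tensor g).add (f'.tensor g))
  | tensor_add {m n m' n' : ℕ} (f : TLTerm k m n) (g g' : TLTerm k m' n') :
      Rel a (f.tensor (g.add g')) ((f.tensor g).add (f.tensor g'))
  | smul_tensor {m n m' n' : ℕ} (c : k) (f : TLTerm k m n) (g : TLTerm k m' n') :
      Rel a ((smul c f).tensor g) (smul c (f.tensor g))
  | tensor_smul {m n m' n' : ℕ} (c : k) (f : TLTerm k m n) (g : TLTerm k m' n') :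
      Rel a (f.tensor (smul c g)) (smul c (f.tensor g))
  -- the monoidal structure is strict
  | id_tensor {m n : ℕ} (f : TLTerm k m n) :
      Rel a (cast (Nat.zero_add m) (Nat.zero_add n) ((id 0).tensor f)) f
  | tensor_id_zero {m n : ℕ} (f : TLTerm k m n) :
      Rel a (cast (Nat.add_zero m) (Nat.add_zero n) (f.tensor (id 0))) f
  | tensor_assoc {m n m' n' m'' n'' : ℕ} (f : TLTerm k m n) (g : TLTerm k m' n')
      (h : TLTerm k m'' n'') :
      Rel a (cast (Nat.add_assoc m m' m'') (Nat.add_assoc n n' n'') ((f.tensor g).tensor h))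
        (f.tensor (g.tensor h))
  -- the defining relations
  | zigzag_left : Rel a
      (comp (m := 1) (n := 3) (p := 1) (tensor (id 1) cup) (tensor cap (id 1))) (smul a (id 1))
  | zigzag_right : Rel a
      (comp (m := 1) (n := 3) (p := 1) (tensor cup (id 1)) (tensor (id 1) cap)) (smul a (id 1))
  | circle : Rel a (comp cup cap) (smul (a ^ 2 + 1) (id 0))

/-- Expressions modulo the relations. -/
@[reducible]
def setoid {k : Type u} [Field k] (a : k) (m n : ℕ) : Setoid (TLTerm k m n) where
  r := Rel a
  iseqv := ⟨Rel.refl, Rel.symm, Rel.trans⟩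

end TLTerm

/-- The objects `[0], [1], [2], …` of the renormalized Temperley--Lieb category with parameter
`a`. -/
structure RenormTL {k : Type u} [Field k] (a : k) : Type where
  /-- the number of points -/
  n : ℕ

namespace RenormTL

variable {k : Type u} [Field k] {a : k}

/-- Morphisms: expressions modulo the relations. -/
def Hom (X Y : RenormTL a) : Type u :=
  Quotient (TLTerm.setoid a X.n Y.n)

instance category : Category.{u} (RenormTL a) where
  Hom X Y := Hom X Y
  id X := Quotient.mk _ (TLTerm.id X.n)
  comp f g := Quotient.map₂ TLTerm.comp (fun _ _ h _ _ h' => TLTerm.Rel.comp_congr h h') f g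
  id_comp f := Quotient.inductionOn f fun f => Quotient.sound (TLTerm.Rel.id_comp f)
  comp_id f := Quotient.inductionOn f fun f => Quotient.sound (TLTerm.Rel.comp_id f)
  assoc f g h := Quotient.inductionOn₃ f g h fun f g h => Quotient.sound (TLTerm.Rel.comp_assoc f g h)

/-- The morphism represented by an expression. -/
def ofTerm (a : k) {m n : ℕ} (f : TLTerm k m n) : (⟨m⟩ : RenormTL a) ⟶ ⟨n⟩ :=
  Quotient.mk _ f

instance (X Y : RenormTL a) : Zero (X ⟶ Y) :=
  ⟨Quotient.mk (TLTerm.setoid a X.n Y.n) (TLTerm.zero X.n Y.n)⟩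

instance (X Y : RenormTL a) : Add (X ⟶ Y) :=
  ⟨Quotient.map₂ TLTerm.add fun _ _ h _ _ h' => TLTerm.Rel.add_congr h h'⟩

instance (X Y : RenormTL a) : Neg (X ⟶ Y) :=
  ⟨Quotient.map (TLTerm.smul (-1)) fun _ _ h => TLTerm.Rel.smul_congr (-1) h⟩

instance (X Y : RenormTL a) : SMul k (X ⟶ Y) :=
  ⟨fun c => Quotient.map (TLTerm.smul c) fun _ _ h => TLTerm.Rel.smul_congr c h⟩

instance (X Y : RenormTL a) : AddCommGroup (X ⟶ Y) where
  add_assoc := by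
    rintro ⟨f⟩ ⟨g⟩ ⟨h⟩
    exact Quot.sound (TLTerm.Rel.add_assoc f g h)
  add_comm := by
    rintro ⟨f⟩ ⟨g⟩
    exact Quot.sound (TLTerm.Rel.add_comm f g)
  zero_add := by
    rintro ⟨f⟩
    exact Quot.sound (TLTerm.Rel.zero_add f)
  add_zero := by
    rintro ⟨f⟩
    exact Quot.sound ((TLTerm.Rel.add_comm _ _).trans (TLTerm.Rel.zero_add f))
  neg_add_cancel := by
    rintro ⟨f⟩
    refine Quot.sound (((TLTerm.Rel.refl _).add_congr (TLTerm.Rel.one_smul f).symm).trans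
      ((TLTerm.Rel.add_smul (-1) 1 f).symm.trans ?_))
    rw [neg_add_cancel]
    exact TLTerm.Rel.zero_smul f
  nsmul := nsmulRec
  zsmul := zsmulRec

instance (X Y : RenormTL a) : Module k (X ⟶ Y) where
  one_smul := by
    rintro ⟨f⟩
    exact Quot.sound (TLTerm.Rel.one_smul f)
  mul_smul := by
    rintro c d ⟨f⟩
    exact Quot.sound (TLTerm.Rel.mul_smul c d f)
  add_smul := by
    rintro c d ⟨f⟩
    exact Quot.sound (TLTerm.Rel.add_smul c d f)
  zero_smul := by
    rintro ⟨f⟩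
    exact Quot.sound (TLTerm.Rel.zero_smul f)
  smul_add := by
    rintro c ⟨f⟩ ⟨g⟩
    exact Quot.sound (TLTerm.Rel.smul_add c f g)
  smul_zero c := by
    refine Quot.sound ((TLTerm.Rel.smul_congr c
      (TLTerm.Rel.zero_smul (TLTerm.zero X.n Y.n)).symm).trans
        ((TLTerm.Rel.mul_smul c 0 _).symm.trans ?_))
    rw [mul_zero]
    exact TLTerm.Rel.zero_smul _

instance preadditive : Preadditive (RenormTL a) where
  add_comp := by
    rintro _ _ _ ⟨f⟩ ⟨f'⟩ ⟨g⟩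
    exact Quot.sound (TLTerm.Rel.add_comp f f' g)
  comp_add := by
    rintro _ _ _ ⟨f⟩ ⟨g⟩ ⟨g'⟩
    exact Quot.sound (TLTerm.Rel.comp_add f g g')

instance linear : Linear k (RenormTL a) where
  smul_comp := by
    rintro _ _ _ c ⟨f⟩ ⟨g⟩
    exact Quot.sound (TLTerm.Rel.smul_comp c f g)
  comp_smul := by
    rintro _ _ _ ⟨f⟩ c ⟨g⟩
    exact Quot.sound (TLTerm.Rel.comp_smul c f g)

end RenormTL

/-- The crystal Temperley--Lieb category `TL₀(k)`: the renormalized one at parameter `0`. -/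
abbrev TLZero (k : Type u) [Field k] : Type :=
  RenormTL (0 : k)

/-- The Cauchy completion of a preadditive category: the Karoubi envelope of its additive
envelope. -/
abbrev CauchyCompletion (C : Type*) [Category C] [Preadditive C] :=
  Idempotents.Karoubi (Mat_ C)

/-- The category `CrysTL`, the Cauchy completion of `TL₀(k)`. -/
abbrev CrysTL (k : Type u) [Field k] :=
  CauchyCompletion (TLZero k)

/-- A simple object: it is nonzero and each of its nonzero endomorphisms is invertible. -/
def IsSimpleObject {C : Type*} [Category C] [Preadditive C] (X : C) : Prop :=
  ¬ IsZero X ∧ ∀ f : X ⟶ X, f ≠ 0 → IsIso f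

/-- A semisimple category: it is additive, and each object is a finite direct sum of simple
objects. -/
def IsSemisimpleCategory (C : Type*) [Category C] [Preadditive C] : Prop :=
  ∃ _ : HasFiniteBiproducts C, ∀ X : C, ∃ (n : ℕ) (S : Fin n → C),
    (∀ i, IsSimpleObject (S i)) ∧ Nonempty (X ≅ ⨁ S)

/-! At parameter 0 the turnback idempotents (cap, then cup, on two neighbouring strands) all
commute: adjacent ones multiply to 0 in both orders by the zig-zag relations, distant ones commute
by interchange. So the product `jw k n` of their complements needs no denominators and kills every
elementary cap and cup. Two facts follow. First, a cup followed by a cap is 0, an identity, or a cap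
followed by a cup, so in `jw ≫ f ≫ jw` every cap can be moved back to the first `jw`, where it dies;
remaining cups die on the second. Hence there are only zero maps between the images of `jw` for
different `n`, and only scalar endomorphisms of each (`jw_comp_comp_jw_of_ne`,
`exists_jw_comp_comp_jw`): nonzero maps are isomorphisms. Second, `𝟙 - jw` starts with caps, so it
factors through fewer strands; by induction every identity is a sum of maps through these images
(`factorsThrough_id`). The rest holds in any preadditive category: a shortest such sum is an
orthogonal decomposition (`exists_orthogonal_decomposition`), and it makes `End X` a sum of simple
left ideals. Zero objects are excluded by minimality, so `jw ≠ 0` need not be checked. -/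

/-! ### Decompositions in preadditive categories -/

namespace CategoryTheory.Preadditive

variable {C : Type*} [Category C] [Preadditive C] {ι : Type*}

/-- The ideal of morphisms that are finite sums of morphisms factoring through members of the
family `S`. -/
inductive FactorsThrough (S : ι → C) : {X Y : C} → (X ⟶ Y) → Prop
  | zero {X Y : C} : FactorsThrough S (0 : X ⟶ Y)
  | add {X Y : C} {f g : X ⟶ Y} :
      FactorsThrough S f → FactorsThrough S g → FactorsThrough S (f + g)
  | comp {X Y : C} (i : ι) (f : X ⟶ S i) (g : S i ⟶ Y) : FactorsThrough S (f ≫ g)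

namespace FactorsThrough

variable {S : ι → C}

theorem comp_left {X Y Z : C} (f : X ⟶ Y) {g : Y ⟶ Z} (hg : FactorsThrough S g) :
    FactorsThrough S (f ≫ g) := by
  induction hg with
  | zero => rw [comp_zero]; exact zero
  | add _ _ h h' => rw [comp_add]; exact add h h'
  | comp i g g' => rw [← Category.assoc]; exact comp i _ _

theorem comp_right {X Y Z : C} {f : X ⟶ Y} (hf : FactorsThrough S f) (g : Y ⟶ Z) :
    FactorsThrough S (f ≫ g) := by
  induction hf with
  | zero => rw [zero_comp]; exact zero
  | add _ _ h h' => rw [add_comp]; exact add h h'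
  | comp i f f' => rw [Category.assoc]; exact comp i _ _

theorem sum {X Y : C} {J : Type*} (s : Finset J) (f : J → (X ⟶ Y))
    (hf : ∀ j ∈ s, FactorsThrough S (f j)) : FactorsThrough S (∑ j ∈ s, f j) :=
  Finset.sum_induction _ (FactorsThrough S) (fun _ _ => add) zero hf

theorem map {D : Type*} [Category D] [Preadditive D] (F : C ⥤ D) [F.Additive] {X Y : C}
    {f : X ⟶ Y} (hf : FactorsThrough S f) : FactorsThrough (fun i => F.obj (S i)) (F.map f) := by
  induction hf with
  | zero => rw [F.map_zero]; exact zero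
  | add _ _ h h' => rw [F.map_add]; exact add h h'
  | comp i f f' => rw [F.map_comp]; exact comp i _ _

theorem trans {κ : Type*} {T : κ → C} (hST : ∀ i, FactorsThrough T (𝟙 (S i))) {X Y : C}
    {f : X ⟶ Y} (hf : FactorsThrough S f) : FactorsThrough T f := by
  induction hf with
  | zero => exact zero
  | add _ _ h h' => exact add h h'
  | comp i f f' =>
    rw [← Category.id_comp f']
    exact ((hST i).comp_right f').comp_left f

theorem exists_sum {X Y : C} {f : X ⟶ Y} (hf : FactorsThrough S f) :
    ∃ (n : ℕ) (s : Fin n → ι) (a : ∀ i, X ⟶ S (s i)) (b : ∀ i, S (s i) ⟶ Y),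
      ∑ i, a i ≫ b i = f := by
  -- Arbitrary finite index types make addition a disjoint union; reindexing by `Fin` is done once.
  suffices h : ∃ (J : Type) (_ : Fintype J) (s : J → ι) (a : ∀ i, X ⟶ S (s i))
      (b : ∀ i, S (s i) ⟶ Y), ∑ i, a i ≫ b i = f by
    obtain ⟨J, _, s, a, b, h⟩ := h
    let e := (Fintype.equivFin J).symm
    exact ⟨_, s ∘ e, fun i => a (e i), fun i => b (e i),
      (e.sum_comp fun j => a j ≫ b j).trans h⟩
  induction hf with
  | zero => exact ⟨Empty, inferInstance, Empty.elim, fun i => i.elim, fun i => i.elim, by simp⟩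
  | add _ _ h h' =>
    obtain ⟨J, _, s, a, b, h⟩ := h
    obtain ⟨J', _, s', a', b', h'⟩ := h'
    refine ⟨J ⊕ J', inferInstance, Sum.elim s s', fun i => Sum.rec a a' i, fun i => Sum.rec b b' i, ?_⟩
    rw [Fintype.sum_sum_type, ← h, ← h']
    rfl
  | comp i f f' => exact ⟨Unit, inferInstance, fun _ => i, fun _ => f, fun _ => f', by simp⟩

end FactorsThrough

/-- If every nonzero morphism between members of `S` is invertible, then an object whose identity
is a sum of morphisms through `S` is a direct sum of nonzero members of `S`. -/
theorem exists_orthogonal_decomposition {S : ι → C}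
    (hS : ∀ i j (f : S i ⟶ S j), f ≠ 0 → IsIso f) {X : C} (hX : FactorsThrough S (𝟙 X)) :
    ∃ (n : ℕ) (s : Fin n → ι) (a : ∀ i, X ⟶ S (s i)) (b : ∀ i, S (s i) ⟶ X),
      ∑ i, a i ≫ b i = 𝟙 X ∧ (∀ i, b i ≫ a i = 𝟙 _) ∧ (∀ i j, i ≠ j → b i ≫ a j = 0) ∧
        ∀ i, ¬ IsZero (S (s i)) := by
  classical
  have hex := hX.exists_sum
  -- Choose an expression of the identity with the fewest terms.
  obtain ⟨s, a, b, hab⟩ := Nat.find_spec hex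
  have hmin : ∀ m < Nat.find hex, ¬ _ := fun m hm => Nat.find_min hex hm
  revert hmin s
  generalize Nat.find hex = n
  intro s a b hab hmin
  -- Minimality makes the `b l` linearly independent: a nonzero coefficient `c j` would be
  -- invertible, so `b j` could be eliminated, leaving a shorter sum.
  have key : ∀ i j (c : ∀ l, S (s i) ⟶ S (s l)), ∑ l, c l ≫ b l = 0 → c j = 0 := by
    intro i j c hc
    by_contra hcj
    have := hS _ _ _ hcj
    obtain _ | n := n
    · exact j.elim0
    refine hmin n n.lt_succ_self ⟨fun l => s (j.succAbove l),
      fun l => a _ - a j ≫ inv (c j) ≫ c (j.succAbove l), fun l => b _, ?_⟩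
    rw [Fin.sum_univ_succAbove _ j] at hc hab
    have hb : b j = -∑ l, inv (c j) ≫ c (j.succAbove l) ≫ b (j.succAbove l) := by
      rw [← comp_sum, ← eq_neg_of_add_eq_zero_left (neg_add_cancel _), ← comp_neg,
        ← eq_neg_of_add_eq_zero_left hc, IsIso.inv_hom_id_assoc]
    simp only [sub_comp, Finset.sum_sub_distrib, Category.assoc]
    rw [← hab]
    conv_rhs => rw [hb]
    rw [comp_neg, comp_sum]
    abel
  -- Both the Kronecker delta and `b i ≫ a l` are coefficients expressing `b i` in terms of the `b
  -- l`, so they agree.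
  have hδ : ∀ i j, (if h : i = j then eqToHom (by rw [h]) else 0) - b i ≫ a j = 0 := by
    intro i j
    refine key i j (fun l => (if h : i = l then eqToHom (by rw [h]) else 0) - b i ≫ a l) ?_
    simp only [sub_comp, Finset.sum_sub_distrib, Category.assoc]
    rw [← comp_sum, hab, Category.comp_id, Finset.sum_eq_single i]
    · simp
    · intro l _ hl
      simp [hl.symm]
    · simp
  refine ⟨n, s, a, b, hab, fun i => ?_, fun i j hij => ?_, fun i hi => ?_⟩
  · have := hδ i i
    simpa using (sub_eq_zero.1 this).symm
  · have := hδ i j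
    rw [dif_neg hij, zero_sub, neg_eq_zero] at this
    exact this
  -- A zero summand could be dropped, contradicting minimality.
  · obtain _ | n := n
    · exact i.elim0
    refine hmin n n.lt_succ_self ⟨fun l => s (i.succAbove l), fun l => a _, fun l => b _, ?_⟩
    rw [Fin.sum_univ_succAbove _ i, hi.eq_of_tgt (a i) 0, zero_comp, zero_add] at hab
    exact hab

theorem nonempty_iso_biproduct {X : C} {n : ℕ} [HasFiniteBiproducts C] (S : Fin n → C)
    (a : ∀ i, X ⟶ S i) (b : ∀ i, S i ⟶ X) (hab : ∑ i, a i ≫ b i = 𝟙 X)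
    (hba : ∀ i, b i ≫ a i = 𝟙 _) (hba' : ∀ i j, i ≠ j → b i ≫ a j = 0) :
    Nonempty (X ≅ ⨁ S) := by
  refine ⟨⟨biproduct.lift a, biproduct.desc b, ?_, ?_⟩⟩
  · rw [biproduct.lift_desc, hab]
  · ext j i
    rw [Category.assoc, biproduct.lift_π, biproduct.ι_desc_assoc, Category.id_comp]
    by_cases h : i = j
    · subst h
      rw [hba, biproduct.ι_π_self]
    · rw [hba' _ _ h, biproduct.ι_π_ne _ h]

/-- The idempotents `e i = a i ≫ b i` sum to 1, so the left ideals they generate span `End X`.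
Multiplication in `End` reverses `≫`, so such an ideal consists of the maps `e i ≫ y`. If this is
nonzero, some component `S i ⟶ S j` of `y` is invertible, and its inverse recovers `e i`; hence the
ideal is simple. -/
theorem isSemisimpleRing_end {X : C} {n : ℕ} (S : Fin n → C)
    (hS : ∀ i j (f : S i ⟶ S j), f ≠ 0 → IsIso f)
    (a : ∀ i, X ⟶ S i) (b : ∀ i, S i ⟶ X) (hab : ∑ i, a i ≫ b i = 𝟙 X)
    (hba : ∀ i, b i ≫ a i = 𝟙 _) (hnz : ∀ i, ¬ IsZero (S i)) : IsSemisimpleRing (End X) := by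
  let e : Fin n → End X := fun i => a i ≫ b i
  have hsimple : ∀ i, IsSimpleModule (End X) (Submodule.span (End X) {e i}) := by
    intro i
    rw [isSimpleModule_iff_isAtom, isAtom_iff_le_of_ge]
    refine ⟨?_, fun N hN hle => ?_⟩
    · rw [Ne, Submodule.span_singleton_eq_bot]
      intro h
      refine hnz i ((IsZero.iff_id_eq_zero _).2 ?_)
      have h' : a i ≫ b i = 0 := h
      have h₁ : b i ≫ (a i ≫ b i) ≫ a i = 𝟙 (S i) := by
        rw [Category.assoc, hba, Category.comp_id, hba]
      rw [← h₁, h', zero_comp, comp_zero]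
    · obtain ⟨x, hx, hx0⟩ := N.ne_bot_iff.1 hN
      obtain ⟨y, rfl⟩ := Submodule.mem_span_singleton.1 (hle hx)
      have hy : b i ≫ (y : X ⟶ X) ≠ 0 := by
        intro h
        apply hx0
        change (a i ≫ b i) ≫ (y : X ⟶ X) = 0
        rw [Category.assoc, h, comp_zero]
      obtain ⟨j, hj⟩ : ∃ j, b i ≫ (y : X ⟶ X) ≫ a j ≠ 0 := by
        by_contra! h
        apply hy
        rw [← Category.comp_id (b i ≫ (y : X ⟶ X)), ← hab, comp_sum]
        refine Finset.sum_eq_zero fun j _ => ?_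
        rw [Category.assoc, ← Category.assoc y, ← Category.assoc, h, zero_comp]
      have := hS _ _ _ hj
      rw [Submodule.span_singleton_le_iff_mem]
      -- Following `e i ≫ y` by this multiplier gives back `e i`.
      have hz := N.smul_mem (a j ≫ inv (b i ≫ (y : X ⟶ X) ≫ a j) ≫ b i : End X) hx
      convert hz
      change a i ≫ b i = ((a i ≫ b i) ≫ (y : X ⟶ X)) ≫ a j ≫ inv (b i ≫ (y : X ⟶ X) ≫ a j) ≫ b i
      have := IsIso.hom_inv_id_assoc (b i ≫ (y : X ⟶ X) ≫ a j) (b i)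
      simp only [Category.assoc] at this ⊢
      rw [this]
  have htop : ⨆ i, Submodule.span (End X) {e i} = ⊤ := by
    rw [eq_top_iff]
    intro x _
    have hx : x = ∑ i, x * e i := by
      rw [← Finset.mul_sum]
      exact (mul_one x).symm.trans (congrArg (x * ·) hab.symm)
    rw [hx]
    exact Submodule.sum_mem _ fun i _ => Submodule.mem_iSup_of_mem i
      (Submodule.mem_span_singleton.2 ⟨x, rfl⟩)
  have := isSemisimpleModule_of_isSemisimpleModule_submodule' (R := End X) (M := End X)
    (p := fun i => Submodule.span (End X) {e i}) (fun i => inferInstance) htop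
  exact this

end CategoryTheory.Preadditive

/-! ### Tensor calculus and generation by elementary cups and caps -/

namespace RenormTL

variable {k : Type u} [Field k] {a : k}

/-- The tensor product of morphisms. -/
def tens {m n m' n' : ℕ} (f : (⟨m⟩ : RenormTL a) ⟶ ⟨n⟩) (g : (⟨m'⟩ : RenormTL a) ⟶ ⟨n'⟩) :
    (⟨m + m'⟩ : RenormTL a) ⟶ ⟨n + n'⟩ :=
  Quotient.map₂ TLTerm.tensor (fun _ _ h _ _ h' => TLTerm.Rel.tensor_congr h h') f g

scoped notation:75 f:76 " ⊠ " g:75 => (tens f g :)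

theorem tens_id (m n : ℕ) :
    𝟙 (⟨m⟩ : RenormTL a) ⊠ 𝟙 (⟨n⟩ : RenormTL a) = 𝟙 (⟨m + n⟩ : RenormTL a) :=
  Quot.sound (TLTerm.Rel.tensor_id m n)

section

variable {m n p m' n' p' : ℕ}

theorem comp_tens_comp (f : (⟨m⟩ : RenormTL a) ⟶ ⟨n⟩) (g : (⟨n⟩ : RenormTL a) ⟶ ⟨p⟩)
    (f' : (⟨m'⟩ : RenormTL a) ⟶ ⟨n'⟩) (g' : (⟨n'⟩ : RenormTL a) ⟶ ⟨p'⟩) :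
    (f ≫ g) ⊠ (f' ≫ g') = (f ⊠ f') ≫ (g ⊠ g') := by
  induction f using Quotient.inductionOn
  induction g using Quotient.inductionOn
  induction f' using Quotient.inductionOn
  induction g' using Quotient.inductionOn
  exact Quot.sound (TLTerm.Rel.interchange _ _ _ _)

theorem add_tens (f g : (⟨m⟩ : RenormTL a) ⟶ ⟨n⟩) (h : (⟨m'⟩ : RenormTL a) ⟶ ⟨n'⟩) :
    (f + g) ⊠ h = f ⊠ h + g ⊠ h := by
  induction f using Quotient.inductionOn
  induction g using Quotient.inductionOn
  induction h using Quotient.inductionOn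
  exact Quot.sound (TLTerm.Rel.add_tensor _ _ _)

theorem tens_add (f : (⟨m⟩ : RenormTL a) ⟶ ⟨n⟩) (g h : (⟨m'⟩ : RenormTL a) ⟶ ⟨n'⟩) :
    f ⊠ (g + h) = f ⊠ g + f ⊠ h := by
  induction f using Quotient.inductionOn
  induction g using Quotient.inductionOn
  induction h using Quotient.inductionOn
  exact Quot.sound (TLTerm.Rel.tensor_add _ _ _)

theorem smul_tens (c : k) (f : (⟨m⟩ : RenormTL a) ⟶ ⟨n⟩) (h : (⟨m'⟩ : RenormTL a) ⟶ ⟨n'⟩) :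
    (c • f) ⊠ h = c • (f ⊠ h) := by
  induction f using Quotient.inductionOn
  induction h using Quotient.inductionOn
  exact Quot.sound (TLTerm.Rel.smul_tensor _ _ _)

theorem tens_smul (c : k) (f : (⟨m⟩ : RenormTL a) ⟶ ⟨n⟩) (h : (⟨m'⟩ : RenormTL a) ⟶ ⟨n'⟩) :
    f ⊠ (c • h) = c • (f ⊠ h) := by
  induction f using Quotient.inductionOn
  induction h using Quotient.inductionOn
  exact Quot.sound (TLTerm.Rel.tensor_smul _ _ _)

theorem zero_tens (h : (⟨m'⟩ : RenormTL a) ⟶ ⟨n'⟩) :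
    (0 : (⟨m⟩ : RenormTL a) ⟶ ⟨n⟩) ⊠ h = 0 := by
  rw [← zero_smul k (0 : (⟨m⟩ : RenormTL a) ⟶ ⟨n⟩), smul_tens, zero_smul]

theorem tens_zero (h : (⟨m'⟩ : RenormTL a) ⟶ ⟨n'⟩) :
    h ⊠ (0 : (⟨m⟩ : RenormTL a) ⟶ ⟨n⟩) = 0 := by
  rw [← zero_smul k (0 : (⟨m⟩ : RenormTL a) ⟶ ⟨n⟩), tens_smul, zero_smul]

theorem sub_tens (f g : (⟨m⟩ : RenormTL a) ⟶ ⟨n⟩) (h : (⟨m'⟩ : RenormTL a) ⟶ ⟨n'⟩) :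
    (f - g) ⊠ h = f ⊠ h - g ⊠ h := by
  rw [eq_sub_iff_add_eq, ← add_tens, sub_add_cancel]

theorem tens_id_comp_id_tens (f : (⟨m⟩ : RenormTL a) ⟶ ⟨n⟩)
    (g : (⟨m'⟩ : RenormTL a) ⟶ ⟨n'⟩) :
    (f ⊠ 𝟙 (⟨m'⟩ : RenormTL a)) ≫ (𝟙 (⟨n⟩ : RenormTL a) ⊠ g) = f ⊠ g := by
  rw [← comp_tens_comp, Category.comp_id, Category.id_comp]

theorem id_tens_comp_tens_id (f : (⟨m⟩ : RenormTL a) ⟶ ⟨n⟩)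
    (g : (⟨m'⟩ : RenormTL a) ⟶ ⟨n'⟩) : 
    (𝟙 (⟨m⟩ : RenormTL a) ⊠ g) ≫ (f ⊠ 𝟙 (⟨n'⟩ : RenormTL a)) = f ⊠ g := by
  rw [← comp_tens_comp, Category.comp_id, Category.id_comp]

theorem comp_tens_id (f : (⟨m⟩ : RenormTL a) ⟶ ⟨n⟩) (g : (⟨n⟩ : RenormTL a) ⟶ ⟨p⟩) (l : ℕ) :
    (f ≫ g) ⊠ 𝟙 (⟨l⟩ : RenormTL a) =
      (f ⊠ 𝟙 (⟨l⟩ : RenormTL a)) ≫ (g ⊠ 𝟙 (⟨l⟩ : RenormTL a)) := by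
  rw [← comp_tens_comp, Category.comp_id]

theorem id_tens_comp (f : (⟨m⟩ : RenormTL a) ⟶ ⟨n⟩) (g : (⟨n⟩ : RenormTL a) ⟶ ⟨p⟩) (l : ℕ) :
    𝟙 (⟨l⟩ : RenormTL a) ⊠ (f ≫ g) =
      (𝟙 (⟨l⟩ : RenormTL a) ⊠ f) ≫ (𝟙 (⟨l⟩ : RenormTL a) ⊠ g) := by
  rw [← comp_tens_comp, Category.comp_id]

theorem tens_id_zero (f : (⟨m⟩ : RenormTL a) ⟶ ⟨n⟩) : f ⊠ 𝟙 (⟨0⟩ : RenormTL a) = f := by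
  induction f using Quotient.inductionOn
  exact Quot.sound (TLTerm.Rel.tensor_id_zero _)

/-- Here `m + l + 1` and `m + (l + 1)` agree definitionally, so associativity needs no cast. This is
why strands are added one at a time on the right. -/
theorem tens_id_tens_id_one (f : (⟨m⟩ : RenormTL a) ⟶ ⟨n⟩) (l : ℕ) :
    (f ⊠ 𝟙 (⟨l⟩ : RenormTL a)) ⊠ 𝟙 (⟨1⟩ : RenormTL a) = f ⊠ 𝟙 (⟨l + 1⟩ : RenormTL a) := by
  rw [← tens_id]
  induction f using Quotient.inductionOn with
  | h f => exact Quot.sound (TLTerm.Rel.tensor_assoc f (TLTerm.id l) (TLTerm.id 1))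

end

/-- The generator `cup`. -/
abbrev cup (a : k) : (⟨0⟩ : RenormTL a) ⟶ ⟨2⟩ := ofTerm a TLTerm.cup

/-- The generator `cap`. -/
abbrev cap (a : k) : (⟨2⟩ : RenormTL a) ⟶ ⟨0⟩ := ofTerm a TLTerm.cap

theorem id_tens_cup_tens_id (i : ℕ) :
    (𝟙 (⟨i⟩ : RenormTL a) ⊠ cup a) ⊠ 𝟙 (⟨1⟩ : RenormTL a) =
      𝟙 (⟨i⟩ : RenormTL a) ⊠ (cup a ⊠ 𝟙 (⟨1⟩ : RenormTL a)) :=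
  Quot.sound (TLTerm.Rel.tensor_assoc (TLTerm.id i) TLTerm.cup (TLTerm.id 1))

theorem id_tens_cap_tens_id (i : ℕ) :
    (𝟙 (⟨i⟩ : RenormTL a) ⊠ cap a) ⊠ 𝟙 (⟨1⟩ : RenormTL a) =
      𝟙 (⟨i⟩ : RenormTL a) ⊠ (cap a ⊠ 𝟙 (⟨1⟩ : RenormTL a)) :=
  Quot.sound (TLTerm.Rel.tensor_assoc (TLTerm.id i) TLTerm.cap (TLTerm.id 1))

theorem id_succ_tens_cup (i : ℕ) :
    𝟙 (⟨i + 1⟩ : RenormTL a) ⊠ cup a =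
      𝟙 (⟨i⟩ : RenormTL a) ⊠ (𝟙 (⟨1⟩ : RenormTL a) ⊠ cup a) := by
  rw [← tens_id]
  exact Quot.sound (TLTerm.Rel.tensor_assoc (TLTerm.id i) (TLTerm.id 1) TLTerm.cup)

theorem id_succ_tens_cap (i : ℕ) :
    𝟙 (⟨i + 1⟩ : RenormTL a) ⊠ cap a =
      𝟙 (⟨i⟩ : RenormTL a) ⊠ (𝟙 (⟨1⟩ : RenormTL a) ⊠ cap a) := by
  rw [← tens_id]
  exact Quot.sound (TLTerm.Rel.tensor_assoc (TLTerm.id i) (TLTerm.id 1) TLTerm.cap)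

/-- The morphisms `id ⊗ cup ⊗ id`. -/
inductive IsCup (a : k) : {m n : ℕ} → ((⟨m⟩ : RenormTL a) ⟶ ⟨n⟩) → Prop
  | base (i : ℕ) : IsCup a (𝟙 (⟨i⟩ : RenormTL a) ⊠ cup a)
  | succ {m n : ℕ} {f : (⟨m⟩ : RenormTL a) ⟶ ⟨n⟩} :
      IsCup a f → IsCup a (f ⊠ 𝟙 (⟨1⟩ : RenormTL a))

/-- The morphisms `id ⊗ cap ⊗ id`. -/
inductive IsCap (a : k) : {m n : ℕ} → ((⟨m⟩ : RenormTL a) ⟶ ⟨n⟩) → Prop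
  | base (i : ℕ) : IsCap a (𝟙 (⟨i⟩ : RenormTL a) ⊠ cap a)
  | succ {m n : ℕ} {f : (⟨m⟩ : RenormTL a) ⟶ ⟨n⟩} :
      IsCap a f → IsCap a (f ⊠ 𝟙 (⟨1⟩ : RenormTL a))

theorem IsCap.source_eq {m n : ℕ} {f : (⟨m⟩ : RenormTL a) ⟶ ⟨n⟩} (hf : IsCap a f) :
    m = n + 2 := by
  induction hf with
  | base i => rfl
  | succ _ ih => omega

theorem IsCup.target_eq {m n : ℕ} {f : (⟨m⟩ : RenormTL a) ⟶ ⟨n⟩} (hf : IsCup a f) :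
    n = m + 2 := by
  induction hf with
  | base i => rfl
  | succ _ ih => omega

/-- The linear combinations of composites of the morphisms `id ⊗ cup ⊗ id` and
`id ⊗ cap ⊗ id`. -/
inductive IsGenerated (a : k) : {m n : ℕ} → ((⟨m⟩ : RenormTL a) ⟶ ⟨n⟩) → Prop
  | cup {m n : ℕ} {f : (⟨m⟩ : RenormTL a) ⟶ ⟨n⟩} : IsCup a f → IsGenerated a f
  | cap {m n : ℕ} {f : (⟨m⟩ : RenormTL a) ⟶ ⟨n⟩} : IsCap a f → IsGenerated a f
  | id (n : ℕ) : IsGenerated a (𝟙 (⟨n⟩ : RenormTL a))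
  | comp {m n p : ℕ} {f : (⟨m⟩ : RenormTL a) ⟶ ⟨n⟩} {g : (⟨n⟩ : RenormTL a) ⟶ ⟨p⟩} :
      IsGenerated a f → IsGenerated a g → IsGenerated a (f ≫ g)
  | add {m n : ℕ} {f g : (⟨m⟩ : RenormTL a) ⟶ ⟨n⟩} :
      IsGenerated a f → IsGenerated a g → IsGenerated a (f + g)
  | smul {m n : ℕ} (c : k) {f : (⟨m⟩ : RenormTL a) ⟶ ⟨n⟩} :
      IsGenerated a f → IsGenerated a (c • f)
  | zero (m n : ℕ) : IsGenerated a (0 : (⟨m⟩ : RenormTL a) ⟶ ⟨n⟩)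

theorem IsGenerated.tens_id_one {m n : ℕ} {f : (⟨m⟩ : RenormTL a) ⟶ ⟨n⟩}
    (hf : IsGenerated a f) : IsGenerated a (f ⊠ 𝟙 (⟨1⟩ : RenormTL a)) := by
  induction hf with
  | cup h => exact cup h.succ
  | cap h => exact cap h.succ
  | id n => rw [tens_id]; exact id _
  | comp _ _ h h' => rw [comp_tens_id]; exact comp h h'
  | add _ _ h h' => rw [add_tens]; exact add h h'
  | smul c _ h => rw [smul_tens]; exact smul c h
  | zero => rw [zero_tens]; exact zero _ _

theorem IsGenerated.tens_id {m n : ℕ} {f : (⟨m⟩ : RenormTL a) ⟶ ⟨n⟩}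
    (hf : IsGenerated a f) (l : ℕ) : IsGenerated a (f ⊠ 𝟙 (⟨l⟩ : RenormTL a)) := by
  induction l with
  | zero => rw [tens_id_zero]; exact hf
  | succ l ih => rw [← tens_id_tens_id_one]; exact ih.tens_id_one

theorem isGenerated_ofTerm_cast {m n m' n' : ℕ} (hm : m = m') (hn : n = n') (f : TLTerm k m n) :
    IsGenerated a (ofTerm a (TLTerm.cast hm hn f)) ↔ IsGenerated a (ofTerm a f) := by
  subst hm hn
  exact Iff.rfl

/-- The strands on the left are arbitrary for the sake of the tensor case: `id ⊗ f ⊗ g` is `id ⊗ f ⊗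
id` followed by `id ⊗ g`, with more identity strands to the left of `g`. -/
theorem isGenerated_id_tens_ofTerm {m n : ℕ} (f : TLTerm k m n) (l : ℕ) :
    IsGenerated a (𝟙 (⟨l⟩ : RenormTL a) ⊠ ofTerm a f) := by
  induction f generalizing l with
  | cup => exact .cup (.base l)
  | cap => exact .cap (.base l)
  | id n =>
    have := IsGenerated.id (a := a) (l + n)
    rw [← tens_id] at this
    exact this
  | comp f g h h' =>
    change IsGenerated a (𝟙 (⟨l⟩ : RenormTL a) ⊠ (ofTerm a f ≫ ofTerm a g))
    rw [id_tens_comp]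
    exact .comp (h l) (h' l)
  | @tensor m n m' n' f g h h' =>
    have hassoc : ofTerm a (TLTerm.cast (Nat.add_assoc l m m') (Nat.add_assoc l n n')
        (((TLTerm.id l).tensor f).tensor g)) = 𝟙 (⟨l⟩ : RenormTL a) ⊠ ofTerm a (f.tensor g) :=
      Quot.sound (TLTerm.Rel.tensor_assoc _ _ _)
    rw [← hassoc, isGenerated_ofTerm_cast]
    change IsGenerated a ((𝟙 (⟨l⟩ : RenormTL a) ⊠ ofTerm a f) ⊠ ofTerm a g)
    rw [← tens_id_comp_id_tens]
    exact .comp ((h l).tens_id _) (h' _)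
  | zero m n =>
    change IsGenerated a (𝟙 (⟨l⟩ : RenormTL a) ⊠ (0 : (⟨m⟩ : RenormTL a) ⟶ ⟨n⟩))
    rw [tens_zero]
    exact .zero _ _
  | add f g h h' =>
    change IsGenerated a (𝟙 (⟨l⟩ : RenormTL a) ⊠ (ofTerm a f + ofTerm a g))
    rw [tens_add]
    exact .add (h l) (h' l)
  | smul c f h =>
    change IsGenerated a (𝟙 (⟨l⟩ : RenormTL a) ⊠ (c • ofTerm a f))
    rw [tens_smul]
    exact .smul c (h l)

theorem isGenerated {m n : ℕ} (f : (⟨m⟩ : RenormTL a) ⟶ ⟨n⟩) : IsGenerated a f := by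
  induction f using Quotient.inductionOn with
  | h f =>
    have h : ofTerm a (TLTerm.cast (Nat.zero_add m) (Nat.zero_add n) ((TLTerm.id 0).tensor f)) =
      ofTerm a f := Quot.sound (TLTerm.Rel.id_tensor f)
    change IsGenerated a (ofTerm a f)
    rw [← h, isGenerated_ofTerm_cast]
    exact isGenerated_id_tens_ofTerm f 0

end RenormTL

/-! ### Relations between cups and caps at parameter 0 -/

namespace RenormTL

variable {k : Type u} [Field k]

theorem cup_comp_cap : cup (0 : k) ≫ cap 0 = 𝟙 _ := by
  have h : cup (0 : k) ≫ cap 0 = ((0 : k) ^ 2 + 1) • 𝟙 _ := Quot.sound TLTerm.Rel.circle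
  rw [h]
  simp

theorem id_tens_cup_comp_cap_tens_id :
    (𝟙 (⟨1⟩ : TLZero k) ⊠ cup 0) ≫ (cap 0 ⊠ 𝟙 (⟨1⟩ : TLZero k)) = 0 :=
  have h : (𝟙 (⟨1⟩ : TLZero k) ⊠ cup 0) ≫ (cap 0 ⊠ 𝟙 (⟨1⟩ : TLZero k)) =
      (0 : k) • 𝟙 (⟨1⟩ : TLZero k) := Quot.sound TLTerm.Rel.zigzag_left
  h.trans (zero_smul k _)

theorem cup_tens_id_comp_id_tens_cap :
    (cup 0 ⊠ 𝟙 (⟨1⟩ : TLZero k)) ≫ (𝟙 (⟨1⟩ : TLZero k) ⊠ cap 0) = 0 :=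
  have h : (cup 0 ⊠ 𝟙 (⟨1⟩ : TLZero k)) ≫ (𝟙 (⟨1⟩ : TLZero k) ⊠ cap 0) =
      (0 : k) • 𝟙 (⟨1⟩ : TLZero k) := Quot.sound TLTerm.Rel.zigzag_right
  h.trans (zero_smul k _)

theorem base_cup_comp_succ_cap (i : ℕ) :
    (𝟙 (⟨i + 1⟩ : TLZero k) ⊠ cup 0) ≫
      ((𝟙 (⟨i⟩ : TLZero k) ⊠ cap 0) ⊠ 𝟙 (⟨1⟩ : TLZero k)) = 0 := by
  rw [id_succ_tens_cup, id_tens_cap_tens_id]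
  refine (id_tens_comp _ _ _).symm.trans ?_
  rw [id_tens_cup_comp_cap_tens_id]
  exact tens_zero _

theorem succ_cup_comp_base_cap (i : ℕ) :
    ((𝟙 (⟨i⟩ : TLZero k) ⊠ cup 0) ⊠ 𝟙 (⟨1⟩ : TLZero k)) ≫
      (𝟙 (⟨i + 1⟩ : TLZero k) ⊠ cap 0) = 0 := by
  rw [id_succ_tens_cap, id_tens_cup_tens_id]
  refine (id_tens_comp _ _ _).symm.trans ?_
  rw [cup_tens_id_comp_id_tens_cap]
  exact tens_zero _

theorem tens_id_one_tens_id_one {m n : ℕ} (f : (⟨m⟩ : TLZero k) ⟶ ⟨n⟩) :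
    (f ⊠ 𝟙 (⟨1⟩ : TLZero k)) ⊠ 𝟙 (⟨1⟩ : TLZero k) = f ⊠ 𝟙 (⟨2⟩ : TLZero k) :=
  tens_id_tens_id_one f 1

theorem tens_id_comp_base_cap {m n : ℕ} (f : (⟨m⟩ : TLZero k) ⟶ ⟨n⟩) :
    (f ⊠ 𝟙 (⟨2⟩ : TLZero k)) ≫ (𝟙 (⟨n⟩ : TLZero k) ⊠ cap 0) =
      (𝟙 (⟨m⟩ : TLZero k) ⊠ cap 0) ≫ f := by
  rw [tens_id_comp_id_tens, ← id_tens_comp_tens_id, tens_id_zero]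

theorem base_cup_comp_tens_id {m n : ℕ} (f : (⟨m⟩ : TLZero k) ⟶ ⟨n⟩) :
    (𝟙 (⟨m⟩ : TLZero k) ⊠ cup 0) ≫ (f ⊠ 𝟙 (⟨2⟩ : TLZero k)) =
      f ≫ (𝟙 (⟨n⟩ : TLZero k) ⊠ cup 0) := by
  rw [id_tens_comp_tens_id, ← tens_id_comp_id_tens, tens_id_zero]

/-- The possible values of a composite of `id ⊗ cup ⊗ id` with `id ⊗ cap ⊗ id`. -/
inductive IsCupComp : {m n : ℕ} → ((⟨m⟩ : TLZero k) ⟶ ⟨n⟩) → Prop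
  | zero (m n : ℕ) : IsCupComp (0 : (⟨m⟩ : TLZero k) ⟶ ⟨n⟩)
  | id (n : ℕ) : IsCupComp (𝟙 (⟨n⟩ : TLZero k))
  | comp {m n p : ℕ} {f : (⟨m⟩ : TLZero k) ⟶ ⟨n⟩} {g : (⟨n⟩ : TLZero k) ⟶ ⟨p⟩} :
      IsCap 0 f → IsCup 0 g → IsCupComp (f ≫ g)

theorem IsCupComp.tens_id_one {m n : ℕ} {f : (⟨m⟩ : TLZero k) ⟶ ⟨n⟩} (hf : IsCupComp f) :
    IsCupComp (f ⊠ 𝟙 (⟨1⟩ : TLZero k)) := by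
  cases hf with
  | zero => rw [zero_tens]; exact zero _ _
  | id => rw [tens_id]; exact id _
  | comp h h' => rw [comp_tens_id]; exact comp h.succ h'.succ

/-- After removing common strands on the right, equal positions give a circle, adjacent positions a
vanishing zig-zag, and distant positions slide past each other. -/
theorem IsCup.comp_cap {m n p : ℕ} {f : (⟨m⟩ : TLZero k) ⟶ ⟨n⟩} {g : (⟨n⟩ : TLZero k) ⟶ ⟨p⟩}
    (hf : IsCup 0 f) (hg : IsCap 0 g) : IsCupComp (f ≫ g) := by
  induction hf generalizing p with
  | base i =>
    cases hg with
    | base =>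
      rw [← id_tens_comp, cup_comp_cap, tens_id]
      exact .id _
    | succ hg =>
      cases hg with
      | base i =>
        have := base_cup_comp_succ_cap (k := k) i
        exact this ▸ .zero _ _
      | @succ _ n g hg =>
        rw [tens_id_one_tens_id_one]
        exact (base_cup_comp_tens_id g) ▸ .comp hg (.base n)
  | @succ m n f hf ih =>
    cases hg with
    | base i =>
      cases hf with
      | base i =>
        have := succ_cup_comp_base_cap (k := k) i
        exact this ▸ .zero _ _
      | @succ m _ f hf =>
        rw [tens_id_one_tens_id_one]
        exact (tens_id_comp_base_cap f) ▸ .comp (.base m) hf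
    | succ hg =>
      rw [← comp_tens_id]
      exact (ih hg).tens_id_one

/-! ### The Jones–Wenzl type idempotents -/

/-- The idempotent `id ⊗ (cup ∘ cap)`. -/
def turnback (k : Type u) [Field k] (n : ℕ) : (⟨n + 2⟩ : TLZero k) ⟶ ⟨n + 2⟩ :=
  𝟙 (⟨n⟩ : TLZero k) ⊠ (cap 0 ≫ cup 0)

theorem turnback_eq (n : ℕ) :
    turnback k n = (𝟙 (⟨n⟩ : TLZero k) ⊠ cap 0) ≫ (𝟙 (⟨n⟩ : TLZero k) ⊠ cup 0) :=
  id_tens_comp _ _ _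

theorem turnback_comp_cap (n : ℕ) :
    turnback k n ≫ (𝟙 (⟨n⟩ : TLZero k) ⊠ cap 0) = 𝟙 (⟨n⟩ : TLZero k) ⊠ cap 0 := by
  rw [turnback, ← id_tens_comp, Category.assoc, cup_comp_cap, Category.comp_id]

theorem cup_comp_turnback (n : ℕ) :
    (𝟙 (⟨n⟩ : TLZero k) ⊠ cup 0) ≫ turnback k n = 𝟙 (⟨n⟩ : TLZero k) ⊠ cup 0 := by
  rw [turnback, ← id_tens_comp, ← Category.assoc, cup_comp_cap, Category.id_comp]

theorem tens_id_comp_turnback {n : ℕ} (f : (⟨n⟩ : TLZero k) ⟶ ⟨n⟩) :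
    (f ⊠ 𝟙 (⟨2⟩ : TLZero k)) ≫ turnback k n = turnback k n ≫ (f ⊠ 𝟙 (⟨2⟩ : TLZero k)) := by
  rw [turnback, tens_id_comp_id_tens, id_tens_comp_tens_id]

theorem turnback_tens_id_comp_turnback (n : ℕ) :
    (turnback k n ⊠ 𝟙 (⟨1⟩ : TLZero k)) ≫ turnback k (n + 1) = 0 := by
  rw [turnback_eq, turnback_eq, comp_tens_id, Category.assoc]
  have := succ_cup_comp_base_cap (k := k) n
  exact (congrArg (fun f => _ ≫ f) ((Category.assoc _ _ _).symm.trans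
    ((congrArg (fun f => f ≫ _) this).trans zero_comp))).trans comp_zero

theorem turnback_comp_turnback_tens_id (n : ℕ) :
    turnback k (n + 1) ≫ (turnback k n ⊠ 𝟙 (⟨1⟩ : TLZero k)) = 0 := by
  rw [turnback_eq, turnback_eq, comp_tens_id, Category.assoc]
  have := base_cup_comp_succ_cap (k := k) n
  exact (congrArg (fun f => _ ≫ f) ((Category.assoc _ _ _).symm.trans
    ((congrArg (fun f => f ≫ _) this).trans zero_comp))).trans comp_zero

/-- The product of all the idempotents `1 - id ⊗ (cup ∘ cap) ⊗ id`, an analogue of the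
Jones--Wenzl idempotent. -/
def jw (k : Type u) [Field k] : (n : ℕ) → ((⟨n⟩ : TLZero k) ⟶ ⟨n⟩)
  | 0 => 𝟙 _
  | 1 => 𝟙 _
  | n + 2 => (jw k (n + 1) ⊠ 𝟙 (⟨1⟩ : TLZero k)) ≫ (𝟙 _ - turnback k n)

/-- The endomorphism `jw ⊗ id`. -/
def jwTens (k : Type u) [Field k] (n : ℕ) : (⟨n + 2⟩ : TLZero k) ⟶ ⟨n + 2⟩ :=
  jw k (n + 1) ⊠ 𝟙 (⟨1⟩ : TLZero k)

theorem jw_add_two (n : ℕ) : jw k (n + 2) = jwTens k n ≫ (𝟙 _ - turnback k n) := by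
  rw [jw]
  rfl

theorem jwTens_succ (n : ℕ) :
    jwTens k (n + 1) = (jw k (n + 1) ⊠ 𝟙 (⟨2⟩ : TLZero k)) ≫
      (𝟙 _ - (turnback k n ⊠ 𝟙 (⟨1⟩ : TLZero k))) := by
  rw [jwTens, jw_add_two, comp_tens_id, sub_tens, tens_id, jwTens, tens_id_one_tens_id_one]

/-- In `jwTens_succ`, the first factor is disjoint from the last turnback, and the second acts as
the identity on it from either side, adjacent turnbacks having product 0. -/
theorem jwTens_comm (n : ℕ) : jwTens k n ≫ turnback k n = turnback k n ≫ jwTens k n := by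
  obtain _ | n := n
  · have : jwTens k 0 = 𝟙 _ := tens_id 1 1
    rw [this, Category.id_comp, Category.comp_id]
  · rw [jwTens_succ]
    have h₁ := turnback_tens_id_comp_turnback (k := k) n
    have h₂ := turnback_comp_turnback_tens_id (k := k) n
    have h₃ := tens_id_comp_turnback (jw k (n + 1))
    have h₄ : (𝟙 _ - (turnback k n ⊠ 𝟙 (⟨1⟩ : TLZero k))) ≫ turnback k (n + 1) =
        turnback k (n + 1) := by
      rw [Preadditive.sub_comp, Category.id_comp]
      exact (congrArg _ h₁).trans (sub_zero _)
    have h₅ : turnback k (n + 1) ≫ (𝟙 _ - (turnback k n ⊠ 𝟙 (⟨1⟩ : TLZero k))) =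
        turnback k (n + 1) := by
      rw [Preadditive.comp_sub, Category.comp_id]
      exact (congrArg _ h₂).trans (sub_zero _)
    rw [Category.assoc, h₄, h₃]
    have h₆ : turnback k (n + 1) ≫ (jw k (n + 1) ⊠ 𝟙 (⟨2⟩ : TLZero k)) ≫
        (𝟙 _ - (turnback k n ⊠ 𝟙 (⟨1⟩ : TLZero k))) =
      (jw k (n + 1) ⊠ 𝟙 (⟨2⟩ : TLZero k)) ≫ turnback k (n + 1) ≫
        (𝟙 _ - (turnback k n ⊠ 𝟙 (⟨1⟩ : TLZero k))) := by
      rw [← Category.assoc]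
      exact (congrArg (fun f => f ≫ _) h₃.symm).trans (Category.assoc _ _ _)
    rw [h₆, h₅, h₃]

theorem jw_add_two' (n : ℕ) : jw k (n + 2) = (𝟙 _ - turnback k n) ≫ jwTens k n := by
  rw [jw_add_two, Preadditive.sub_comp, Preadditive.comp_sub, jwTens_comm, Category.id_comp,
    Category.comp_id]

/-- The rightmost cap is killed by the factor `𝟙 - turnback`, any other by `jwTens` and induction;
commutation lets either factor be put next to the cap. -/
theorem IsCap.jw_comp {n p : ℕ} {f : (⟨n⟩ : TLZero k) ⟶ ⟨p⟩} (hf : IsCap 0 f) :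
    jw k n ≫ f = 0 := by
  induction hf with
  | base n =>
    rw [jw_add_two, Category.assoc, Preadditive.sub_comp, turnback_comp_cap, Category.id_comp,
      sub_self, comp_zero]
  | @succ n p f hf ih =>
    obtain rfl := hf.source_eq
    rw [jw_add_two' (p + 1), Category.assoc]
    have h : jwTens k (p + 1) ≫ (f ⊠ 𝟙 (⟨1⟩ : TLZero k)) = 0 := by
      refine (comp_tens_id _ _ _).symm.trans ?_
      rw [ih, zero_tens]
    exact (congrArg (fun f => _ ≫ f) h).trans comp_zero

theorem IsCup.comp_jw {n p : ℕ} {f : (⟨n⟩ : TLZero k) ⟶ ⟨p⟩} (hf : IsCup 0 f) :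
    f ≫ jw k p = 0 := by
  induction hf with
  | base n =>
    rw [jw_add_two', ← Category.assoc, Preadditive.comp_sub, cup_comp_turnback, Category.comp_id,
      sub_self, zero_comp]
  | @succ n p f hf ih =>
    obtain rfl := hf.target_eq
    rw [jw_add_two (n + 1), ← Category.assoc]
    have h : (f ⊠ 𝟙 (⟨1⟩ : TLZero k)) ≫ jwTens k (n + 1) = 0 := by
      refine (comp_tens_id _ _ _).symm.trans ?_
      rw [ih, zero_tens]
    exact (congrArg (fun f => f ≫ _) h).trans zero_comp

/-- The right ideal of morphisms generated by the morphisms `id ⊗ cap ⊗ id`. -/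
inductive CapIdeal : {m n : ℕ} → ((⟨m⟩ : TLZero k) ⟶ ⟨n⟩) → Prop
  | zero (m n : ℕ) : CapIdeal (0 : (⟨m⟩ : TLZero k) ⟶ ⟨n⟩)
  | add {m n : ℕ} {f g : (⟨m⟩ : TLZero k) ⟶ ⟨n⟩} : CapIdeal f → CapIdeal g → CapIdeal (f + g)
  | comp {m n p : ℕ} {f : (⟨m⟩ : TLZero k) ⟶ ⟨n⟩} (hf : IsCap 0 f)
      (g : (⟨n⟩ : TLZero k) ⟶ ⟨p⟩) : CapIdeal (f ≫ g)

namespace CapIdeal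

theorem tens_id_one {m n : ℕ} {f : (⟨m⟩ : TLZero k) ⟶ ⟨n⟩} (hf : CapIdeal f) :
    CapIdeal (f ⊠ 𝟙 (⟨1⟩ : TLZero k)) := by
  induction hf with
  | zero => rw [zero_tens]; exact zero _ _
  | add _ _ h h' => rw [add_tens]; exact add h h'
  | comp h g => rw [comp_tens_id]; exact comp h.succ _

theorem id_sub_jw (n : ℕ) : CapIdeal (𝟙 _ - jw k n) := by
  induction n with
  | zero => rw [jw, sub_self]; exact zero _ _
  | succ n ih =>
    obtain _ | n := n
    · rw [jw, sub_self]; exact zero _ _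
    · have h := ih.tens_id_one
      rw [sub_tens, tens_id] at h
      have h' := comp (.base n) ((𝟙 (⟨n⟩ : TLZero k) ⊠ cup 0) ≫ jwTens k n)
      rw [← Category.assoc, ← turnback_eq] at h'
      -- With `e` the last turnback, `𝟙 - jw = (𝟙 - jwTens) + e ≫ jwTens`, and `e` begins with a
      -- cap.
      convert add h h' using 1
      rw [jw_add_two', Preadditive.sub_comp, Category.id_comp, ← sub_add]
      rfl

theorem jw_comp {m n : ℕ} {f : (⟨m⟩ : TLZero k) ⟶ ⟨n⟩} (hf : CapIdeal f) : jw k m ≫ f = 0 := by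
  induction hf with
  | zero => exact comp_zero
  | add _ _ h h' => rw [Preadditive.comp_add, h, h', add_zero]
  | comp h g => rw [← Category.assoc, h.jw_comp, zero_comp]

end CapIdeal

theorem jw_comp_jw (n : ℕ) : jw k n ≫ jw k n = jw k n := by
  have := (CapIdeal.id_sub_jw (k := k) n).jw_comp
  rw [Preadditive.comp_sub, Category.comp_id, sub_eq_zero] at this
  exact this.symm

/-! ### Morphisms between the images of the idempotents -/

/-- The linear combinations of composites of `jw` with morphisms `id ⊗ cup ⊗ id`. -/
inductive JwCup (m : ℕ) : {n : ℕ} → ((⟨m⟩ : TLZero k) ⟶ ⟨n⟩) → Prop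
  | of_jw : JwCup m (jw k m)
  | comp {n p : ℕ} {f : (⟨m⟩ : TLZero k) ⟶ ⟨n⟩} {g : (⟨n⟩ : TLZero k) ⟶ ⟨p⟩} :
      JwCup m f → IsCup 0 g → JwCup m (f ≫ g)
  | zero (n : ℕ) : JwCup m (0 : (⟨m⟩ : TLZero k) ⟶ ⟨n⟩)
  | add {n : ℕ} {f g : (⟨m⟩ : TLZero k) ⟶ ⟨n⟩} : JwCup m f → JwCup m g → JwCup m (f + g)
  | smul {n : ℕ} (c : k) {f : (⟨m⟩ : TLZero k) ⟶ ⟨n⟩} : JwCup m f → JwCup m (c • f)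

namespace JwCup

variable {m n p : ℕ} {f : (⟨m⟩ : TLZero k) ⟶ ⟨n⟩}

/-- The cap moves back through the cups until it cancels, vanishes, or reaches `jw` and dies. -/
theorem comp_cap (hf : JwCup m f) {g : (⟨n⟩ : TLZero k) ⟶ ⟨p⟩} (hg : IsCap 0 g) :
    JwCup m (f ≫ g) := by
  induction hf generalizing p with
  | of_jw => rw [hg.jw_comp]; exact zero _
  | @comp _ _ f f' hf hf' ih =>
    rw [Category.assoc]
    have := hf'.comp_cap hg
    generalize f' ≫ g = f'' at this
    cases this with
    | zero => rw [comp_zero]; exact zero _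
    | id => rw [Category.comp_id]; exact hf
    | comp h h' => rw [← Category.assoc]; exact comp (ih h) h'
  | zero => rw [zero_comp]; exact zero _
  | add _ _ h h' => rw [Preadditive.add_comp]; exact add (h hg) (h' hg)
  | smul c _ h => rw [Linear.smul_comp]; exact smul c (h hg)

theorem comp_right (hf : JwCup m f) (g : (⟨n⟩ : TLZero k) ⟶ ⟨p⟩) : JwCup m (f ≫ g) := by
  induction isGenerated g with
  | cup h => exact comp hf h
  | cap h => exact hf.comp_cap h
  | id => rw [Category.comp_id]; exact hf
  | comp _ _ h h' => rw [← Category.assoc]; exact h' (h hf)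
  | add _ _ h h' => rw [Preadditive.comp_add]; exact add (h hf) (h' hf)
  | smul c _ h => rw [Linear.comp_smul]; exact smul c (h hf)
  | zero => rw [comp_zero]; exact zero _

/-- Every term ending in a cup is killed by the final `jw`; only multiples of `jw` itself survive.
-/
theorem exists_comp_jw (hf : JwCup m f) :
    ∃ c : k, f ≫ jw k n = c • if h : m = n then eqToHom (by rw [h]) ≫ jw k n else 0 := by
  induction hf with
  | of_jw => exact ⟨1, by simp [jw_comp_jw]⟩
  | comp _ h => exact ⟨0, by rw [Category.assoc, h.comp_jw, comp_zero, zero_smul]⟩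
  | zero => exact ⟨0, by rw [zero_comp, zero_smul]⟩
  | add _ _ h h' =>
    obtain ⟨c, h⟩ := h
    obtain ⟨c', h'⟩ := h'
    exact ⟨c + c', by rw [Preadditive.add_comp, h, h', add_smul]⟩
  | smul c _ h =>
    obtain ⟨c', h⟩ := h
    exact ⟨c * c', by rw [Linear.smul_comp, h, mul_smul]⟩

end JwCup

theorem jw_comp_comp_jw_of_ne {m n : ℕ} (h : m ≠ n) (f : (⟨m⟩ : TLZero k) ⟶ ⟨n⟩) :
    jw k m ≫ f ≫ jw k n = 0 := by
  obtain ⟨c, hc⟩ := (JwCup.of_jw.comp_right f).exists_comp_jw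
  rw [← Category.assoc, hc, dif_neg h, smul_zero]

theorem exists_jw_comp_comp_jw {n : ℕ} (f : (⟨n⟩ : TLZero k) ⟶ ⟨n⟩) :
    ∃ c : k, jw k n ≫ f ≫ jw k n = c • jw k n := by
  obtain ⟨c, hc⟩ := (JwCup.of_jw.comp_right f).exists_comp_jw
  exact ⟨c, by rw [← Category.assoc, hc, dif_pos rfl, eqToHom_refl, Category.id_comp]⟩

end RenormTL

/-! ### Simple objects and factorizations in the Cauchy completion -/

namespace RenormTL

variable (k : Type u) [Field k]

open Idempotents Preadditive

/-- The inclusion of `TL₀(k)` into its Cauchy completion. -/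
noncomputable abbrev toCrysTL : TLZero k ⥤ CrysTL k := Mat_.embedding (TLZero k) ⋙ toKaroubi _

/-- The image of the idempotent `jw`. -/
noncomputable def jwObj (n : ℕ) : CrysTL k where
  X := (Mat_.embedding (TLZero k)).obj ⟨n⟩
  p := (Mat_.embedding (TLZero k)).map (jw k n)
  idem := by rw [← Functor.map_comp, jw_comp_jw]

variable {k}

theorem exists_hom_f_eq {m n : ℕ} (f : jwObj k m ⟶ jwObj k n) :
    ∃ g : (⟨m⟩ : TLZero k) ⟶ ⟨n⟩,
      f.f = (Mat_.embedding (TLZero k)).map (jw k m ≫ g ≫ jw k n) := by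
  obtain ⟨g, hg⟩ := (Mat_.embedding (TLZero k)).map_surjective f.f
  refine ⟨g, ?_⟩
  rw [Functor.map_comp, Functor.map_comp, hg]
  exact f.comm.symm

/-- The endomorphism of the image of `jw` given by a scalar. -/
noncomputable def jwScalar (n : ℕ) (c : k) : jwObj k n ⟶ jwObj k n where
  f := (Mat_.embedding (TLZero k)).map (c • jw k n)
  comm := by
    change (Mat_.embedding (TLZero k)).map (jw k n) ≫
      (Mat_.embedding (TLZero k)).map (c • jw k n) ≫ (Mat_.embedding (TLZero k)).map (jw k n) =
      (Mat_.embedding (TLZero k)).map (c • jw k n)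
    rw [← Functor.map_comp, ← Functor.map_comp, Linear.smul_comp, Linear.comp_smul, jw_comp_jw,
      jw_comp_jw]

theorem jwScalar_one (n : ℕ) : jwScalar n (1 : k) = 𝟙 (jwObj k n) := by
  apply Karoubi.hom_ext
  change (Mat_.embedding (TLZero k)).map ((1 : k) • jw k n) =
    (Mat_.embedding (TLZero k)).map (jw k n)
  rw [one_smul]

theorem jwScalar_comp (n : ℕ) (c d : k) : jwScalar n c ≫ jwScalar n d = jwScalar n (c * d) := by
  apply Karoubi.hom_ext
  change (Mat_.embedding (TLZero k)).map (c • jw k n) ≫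
    (Mat_.embedding (TLZero k)).map (d • jw k n) =
      (Mat_.embedding (TLZero k)).map ((c * d) • jw k n)
  rw [← Functor.map_comp, Linear.smul_comp, Linear.comp_smul, jw_comp_jw, smul_smul]

theorem jwScalar_zero (n : ℕ) : jwScalar n (0 : k) = 0 := by
  apply Karoubi.hom_ext
  change (Mat_.embedding (TLZero k)).map ((0 : k) • jw k n) = 0
  rw [zero_smul]
  exact Functor.map_zero _ _ _

theorem isIso_of_ne_zero (m n : ℕ) (f : jwObj k m ⟶ jwObj k n) (hf : f ≠ 0) : IsIso f := by
  obtain ⟨g, hg⟩ := exists_hom_f_eq f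
  obtain rfl | hmn := eq_or_ne m n
  · obtain ⟨c, hc⟩ := exists_jw_comp_comp_jw g
    rw [hc] at hg
    obtain rfl : f = jwScalar m c := Karoubi.hom_ext _ _ hg
    have hc0 : c ≠ 0 := by
      rintro rfl
      exact hf (jwScalar_zero m)
    refine ⟨jwScalar m c⁻¹, ?_, ?_⟩
    · rw [jwScalar_comp, mul_inv_cancel₀ hc0, jwScalar_one]
    · rw [jwScalar_comp, inv_mul_cancel₀ hc0, jwScalar_one]
  · rw [jw_comp_comp_jw_of_ne hmn] at hg
    exact absurd (Karoubi.hom_eq_zero_iff.2 (hg.trans (Functor.map_zero _ _ _))) hf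

theorem factorsThrough_map_jw (n : ℕ) :
    FactorsThrough (jwObj k) ((toCrysTL k).map (jw k n)) := by
  have h := FactorsThrough.comp (S := jwObj k) n (Karoubi.decompId_p (jwObj k n))
    (Karoubi.decompId_i (jwObj k n))
  rw [← Karoubi.decomp_p] at h
  exact h

/-- Split the identity as `(𝟙 - jw) + jw`: the first part passes through `n - 2` strands, where
induction applies, and the second through `jwObj k n`. -/
theorem factorsThrough_id_toCrysTL (n : ℕ) :
    FactorsThrough (jwObj k) (𝟙 ((toCrysTL k).obj ⟨n⟩)) := by
  induction n using Nat.strong_induction_on with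
  | _ n ih =>
    have hideal : ∀ {p : ℕ} {f : (⟨n⟩ : TLZero k) ⟶ ⟨p⟩}, CapIdeal f →
        FactorsThrough (jwObj k) ((toCrysTL k).map f) := by
      intro p f hf
      induction hf with
      | zero => rw [Functor.map_zero]; exact .zero
      | add _ _ h h' => rw [Functor.map_add]; exact .add h h'
      | comp hf g =>
        rw [Functor.map_comp, ← Category.id_comp ((toCrysTL k).map g)]
        have := hf.source_eq
        exact ((ih _ (by omega)).comp_right _).comp_left _
    have h := (hideal (CapIdeal.id_sub_jw (k := k) n)).add (factorsThrough_map_jw n)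
    rwa [← Functor.map_add, sub_add_cancel, CategoryTheory.Functor.map_id] at h

/-- Every object is a retract of a finite biproduct of objects of `TLZero k`. -/
theorem factorsThrough_id (X : CrysTL k) : FactorsThrough (jwObj k) (𝟙 X) := by
  have hM : ∀ M : Mat_ (TLZero k),
      FactorsThrough (fun n : ℕ => (Mat_.embedding (TLZero k)).obj ⟨n⟩) (𝟙 M) := by
    intro M
    rw [← M.isoBiproductEmbedding.hom_inv_id, ← Category.id_comp M.isoBiproductEmbedding.inv,
      ← biproduct.total]
    refine FactorsThrough.comp_left _ (FactorsThrough.comp_right ?_ _)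
    exact FactorsThrough.sum _ _ fun i _ => FactorsThrough.comp (M.X i).n _ _
  rw [Karoubi.decompId X, ← Category.id_comp (Karoubi.decompId_p X)]
  refine FactorsThrough.comp_left _ (FactorsThrough.comp_right ?_ _)
  have h := ((hM X.X).map (toKaroubi _)).trans factorsThrough_id_toCrysTL
  rwa [CategoryTheory.Functor.map_id] at h

end RenormTL

theorem mainTheorem7 (k : Type u) [Field k] :
    IsSemisimpleCategory (CrysTL k) ∧ ∀ X : CrysTL k, IsSemisimpleRing (End X) := by
  refine ⟨⟨inferInstance, fun X => ?_⟩, fun X => ?_⟩ <;>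
    obtain ⟨n, s, a, b, hab, hba, hba', hnz⟩ := Preadditive.exists_orthogonal_decomposition
      RenormTL.isIso_of_ne_zero (RenormTL.factorsThrough_id X)
  · exact ⟨n, fun i => RenormTL.jwObj k (s i),
      fun i => ⟨hnz i, RenormTL.isIso_of_ne_zero _ _⟩,
      Preadditive.nonempty_iso_biproduct _ a b hab hba hba'⟩
  · exact Preadditive.isSemisimpleRing_end _ (fun _ _ => RenormTL.isIso_of_ne_zero _ _)
      a b hab hba hnz
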